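/- Let $n\ge 1$, let $p\in(1,\infty)$ and let $f\in W^{1,p}(\mathbb{R}^n)$, with weak gradient $\nabla_w f\in L^p(\mathbb{R}^n;\mathbb{R}^n)$. For $\alpha\in(0,1)$ put $$\mu_{n,\alpha}=2^{\alpha}\pi^{-n/2}\,\frac{\Gamma\big(\frac{n+\alpha+1}{2}\big)}{\Gamma\big(\frac{1-\alpha}{2}\big)},\qquad \operatorname{div}^{\alpha}\varphi(x)=\mu_{n,\alpha}\int_{\mathbb{R}^n}\frac{(y-x)\cdot(\varphi(y)-\varphi(x))}{|y-x|^{n+\alpha+1}}\,dy$$ for $\varphi\in C_c^\infty(\mathbb{R}^n;\mathbb{R}^n)$. The weak fractional $\alpha$-gradient of $f$ is the (a.e. unique) function $\nabla^\alpha_w f\in L^1_{\mathrm{loc}}(\mathbb{R}^n;\mathbb{R}^n)$, if it exists, such that $\int_{\mathbb{R}^n} f\,\operatorname{div}^\alpha\varphi\,dx=-\int_{\mathbb{R}^n}\nabla^\alpha_w f\cdot\varphi\,dx$ for all $\varphi\in C_c^\infty(\mathbb{R}^n;\mathbb{R}^n)$, and $S^{\alpha,p}(\mathbb{R}^n)$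 is the space of those functions in $L^p(\mathbb{R}^n)$ which have a weak fractional $\alpha$-gradient in $L^p(\mathbb{R}^n;\mathbb{R}^n)$. Then $f\in S^{\alpha,p}(\mathbb{R}^n)$ for every $\alpha\in(0,1)$, and $$\lim_{\alpha\to1^-}\|\nabla^\alpha_w f-\nabla_w f\|_{L^p(\mathbb{R}^n;\,\mathbb{R}^n)}=0.$$ -/

import Mathlib

open MeasureTheory Set Filter Topology
open scoped ENNReal

/-- Vector fields in `C_c^∞(ℝⁿ; ℝⁿ)`. -/
def IsTestField {n : ℕ} (φ : EuclideanSpace ℝ (Fin n) → EuclideanSpace ℝ (Fin n)) : Prop :=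
  ContDiff ℝ ((⊤ : ℕ∞) : WithTop ℕ∞) φ ∧ HasCompactSupport φ

/-- The divergence `∑ᵢ ∂ᵢ φᵢ` of a differentiable vector field. -/
noncomputable def divergence {n : ℕ}
    (φ : EuclideanSpace ℝ (Fin n) → EuclideanSpace ℝ (Fin n)) (x : EuclideanSpace ℝ (Fin n)) : ℝ :=
  ∑ i : Fin n, (fderiv ℝ φ x (EuclideanSpace.single i 1)) i

/-- The constant `μ_{n,α} = 2^α π^{-n/2} Γ((n+α+1)/2) / Γ((1-α)/2)`. -/
noncomputable def fracConst (n : ℕ) (α : ℝ) : ℝ :=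
  (2 : ℝ) ^ α * Real.pi ^ (-((n : ℝ) / 2)) *
    (Real.Gamma (((n : ℝ) + α + 1) / 2) / Real.Gamma ((1 - α) / 2))

/-- The fractional `α`-divergence
`μ_{n,α} ∫ (y - x) · (φ(y) - φ(x)) / |y - x|^{n+α+1} dy`. -/
noncomputable def fracDivergence {n : ℕ} (α : ℝ)
    (φ : EuclideanSpace ℝ (Fin n) → EuclideanSpace ℝ (Fin n)) (x : EuclideanSpace ℝ (Fin n)) : ℝ :=
  fracConst n α * ∫ y, inner ℝ (y - x) (φ y - φ x) / ‖y - x‖ ^ ((n : ℝ) + α + 1)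

/-- `g ∈ L¹_loc(ℝⁿ; ℝⁿ)` is the weak gradient of `f` (unique up to null sets);
used for `f ∈ Lᵖ(ℝⁿ)`. -/
def IsWeakGradient {n : ℕ} (f : EuclideanSpace ℝ (Fin n) → ℝ)
    (g : EuclideanSpace ℝ (Fin n) → EuclideanSpace ℝ (Fin n)) : Prop :=
  LocallyIntegrable g volume ∧
    ∀ φ : EuclideanSpace ℝ (Fin n) → EuclideanSpace ℝ (Fin n), IsTestField φ →
      ∫ x, f x * divergence φ x = -∫ x, inner ℝ (g x) (φ x)

/-- `g ∈ L¹_loc(ℝⁿ; ℝⁿ)` is the weak fractional `α`-gradient of `f` (unique up to null sets);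
used for `f ∈ Lᵖ(ℝⁿ)` and `α ∈ (0,1)`. -/
def IsWeakFracGradient {n : ℕ} (α : ℝ) (f : EuclideanSpace ℝ (Fin n) → ℝ)
    (g : EuclideanSpace ℝ (Fin n) → EuclideanSpace ℝ (Fin n)) : Prop :=
  LocallyIntegrable g volume ∧
    ∀ φ : EuclideanSpace ℝ (Fin n) → EuclideanSpace ℝ (Fin n), IsTestField φ →
      ∫ x, f x * fracDivergence α φ x = -∫ x, inner ℝ (g x) (φ x)

/-- The Sobolev space `W^{1,p}(ℝⁿ)`. -/
def MemSobolevOne {n : ℕ} (p : ℝ≥0∞) (f : EuclideanSpace ℝ (Fin n) → ℝ) : Prop :=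
  MemLp f p volume ∧
    ∃ g : EuclideanSpace ℝ (Fin n) → EuclideanSpace ℝ (Fin n),
      IsWeakGradient f g ∧ MemLp g p volume

/-- The distributional fractional Sobolev space `S^{α,p}(ℝⁿ)`. -/
def MemFracSobolev {n : ℕ} (α : ℝ) (p : ℝ≥0∞) (f : EuclideanSpace ℝ (Fin n) → ℝ) : Prop :=
  MemLp f p volume ∧
    ∃ g : EuclideanSpace ℝ (Fin n) → EuclideanSpace ℝ (Fin n),
      IsWeakFracGradient α f g ∧ MemLp g p volume

/-! Regard Ψ(h) = f(· + h) - f as a map from ℝⁿ to Lᵖ. A weak gradient g in Lᵖ makes Ψ Fréchet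
differentiable at 0 with derivative D : h ↦ g · h (`hasFDerivAt_lpTranslate`). Since Ψ is bounded
and O(|h|) at 0, the Bochner integrals μ_{n,α} ∫ h_i |h|^{-n-α-1} Ψ(h) dh converge in Lᵖ for every α
in (0,1). By Fubini against test functions, they are the components of the weak fractional gradient
(`isWeakFracGradient_of_integrable`).

As α → 1⁻, μ_{n,α} vanishes like (1 - α)/|B₁|, so the contribution from outside any fixed ball
disappears. Inside a small ball Ψ is nearly D, and the second moments of the kernel are exactly
those that turn D into D(e_i) in the limit. Hence the i-th component tends to D(e_i) = g_i in Lᵖ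
(`tendsto_fracConst_smul_integral`); this step holds for maps into any Banach space. -/

/-! ### Translations in Lᵖ and their derivative at 0. -/

section Translation

variable {n : ℕ} {p : ℝ≥0∞}

/-- Translation `u ↦ u (· + h)` on `Lᵖ(ℝⁿ)`. -/
noncomputable def lpTranslate [Fact (1 ≤ p)] (h : EuclideanSpace ℝ (Fin n)) :
    Lp ℝ p (volume : Measure (EuclideanSpace ℝ (Fin n))) →ₗᵢ[ℝ]
      Lp ℝ p (volume : Measure (EuclideanSpace ℝ (Fin n))) :=
  Lp.compMeasurePreservingₗᵢ ℝ (fun x => x + h) (measurePreserving_add_right volume h)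

theorem lpTranslate_coeFn [Fact (1 ≤ p)] (h : EuclideanSpace ℝ (Fin n))
    (u : Lp ℝ p (volume : Measure (EuclideanSpace ℝ (Fin n)))) :
    lpTranslate h u =ᵐ[volume] fun x => u (x + h) :=
  Lp.coeFn_compMeasurePreserving u (measurePreserving_add_right volume h)

theorem continuous_lpTranslate [Fact (1 ≤ p)] (hp : p ≠ ⊤)
    (u : Lp ℝ p (volume : Measure (EuclideanSpace ℝ (Fin n)))) :
    Continuous fun h => lpTranslate h u := by
  have hg : Continuous fun h : EuclideanSpace ℝ (Fin n) =>
      (⟨fun x => x + h, by fun_prop⟩ : C(EuclideanSpace ℝ (Fin n), EuclideanSpace ℝ (Fin n))) :=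
    ContinuousMap.continuous_of_continuous_uncurry _ (by
      simp only [Function.uncurry_def, ContinuousMap.coe_mk]; fun_prop)
  exact Continuous.compMeasurePreservingLp (continuous_const (y := u)) hg
    (fun h => measurePreserving_add_right volume h) hp

theorem lpTranslate_zero [Fact (1 ≤ p)]
    (u : Lp ℝ p (volume : Measure (EuclideanSpace ℝ (Fin n)))) : lpTranslate 0 u = u := by
  apply Lp.ext
  filter_upwards [lpTranslate_coeFn 0 u] with x hx
  rw [hx, add_zero]

/-- Integration against a continuous compactly supported function is a continuous functional on
`Lᵖ`. -/
theorem exists_pairing [hp : Fact (1 ≤ p)] {ψ : EuclideanSpace ℝ (Fin n) → ℝ}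
    (hψ : Continuous ψ) (hc : HasCompactSupport ψ) :
    ∃ L : Lp ℝ p (volume : Measure (EuclideanSpace ℝ (Fin n))) →L[ℝ] ℝ,
      ∀ u, L u = ∫ x, u x * ψ x := by
  -- The conjugate exponent is taken in `ℝ≥0∞`, so that p = 1 gives ⊤ without a separate case.
  have := ENNReal.HolderConjugate.inv_one_sub_inv' hp.out
  have : Fact (1 ≤ (1 - p⁻¹)⁻¹) := by simp [fact_iff]
  have hm : MemLp ψ (1 - p⁻¹)⁻¹ volume := hψ.memLp_of_hasCompactSupport hc
  refine ⟨((ContinuousLinearMap.mul ℝ ℝ).lpPairing volume p (1 - p⁻¹)⁻¹).flip hm.toLp, fun u => ?_⟩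
  rw [ContinuousLinearMap.flip_apply, ContinuousLinearMap.lpPairing_eq_integral]
  refine integral_congr_ae ?_
  filter_upwards [hm.coeFn_toLp] with x hx
  simp [hx]

theorem integral_lpTranslate_mul [Fact (1 ≤ p)] (h : EuclideanSpace ℝ (Fin n))
    (u : Lp ℝ p (volume : Measure (EuclideanSpace ℝ (Fin n)))) (ψ : EuclideanSpace ℝ (Fin n) → ℝ) :
    ∫ x, lpTranslate h u x * ψ x = ∫ x, u x * ψ (x - h) := by
  rw [← integral_add_right_eq_self (fun x => u x * ψ (x - h)) h]
  refine integral_congr_ae ?_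
  filter_upwards [lpTranslate_coeFn h u] with x hx
  simp [hx]

theorem Lp.eq_of_forall_integral_mul_eq [hp : Fact (1 ≤ p)]
    {u v : Lp ℝ p (volume : Measure (EuclideanSpace ℝ (Fin n)))}
    (h : ∀ ψ : EuclideanSpace ℝ (Fin n) → ℝ, ContDiff ℝ ((⊤ : ℕ∞) : WithTop ℕ∞) ψ →
      HasCompactSupport ψ → ∫ x, u x * ψ x = ∫ x, v x * ψ x) : u = v := by
  apply Lp.ext
  refine ae_eq_of_integral_contDiff_smul_eq ((Lp.memLp u).locallyIntegrable hp.out)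
    ((Lp.memLp v).locallyIntegrable hp.out) fun ψ h1 h2 => ?_
  simpa [mul_comm] using h ψ h1 h2

/-- The integral is the convolution of `f` with y ↦ ψ(-y), evaluated at t • h, so the
differentiability of convolutions applies along a line. -/
theorem hasDerivAt_integral_mul_comp_sub_smul {f : EuclideanSpace ℝ (Fin n) → ℝ}
    (hf : LocallyIntegrable f volume) {ψ : EuclideanSpace ℝ (Fin n) → ℝ}
    (hψ : ContDiff ℝ 1 ψ) (hc : HasCompactSupport ψ) (h : EuclideanSpace ℝ (Fin n)) (t : ℝ) :
    HasDerivAt (fun t : ℝ => ∫ x, f x * ψ (x - t • h))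
      (-∫ x, f x * fderiv ℝ ψ (x - t • h) h) t := by
  have hc' : HasCompactSupport fun y => ψ (-y) := hc.comp_homeomorph (Homeomorph.neg _)
  have hψ' : ContDiff ℝ 1 fun y => ψ (-y) := hψ.comp contDiff_neg
  have key := hc'.hasFDerivAt_convolution_right (ContinuousLinearMap.mul ℝ ℝ) hf hψ' (t • h)
  have hline : HasDerivAt (fun t : ℝ => t • h) h t := by
    simpa using (hasDerivAt_id t).smul_const h
  have h1 := key.comp_hasDerivAt t hline
  rw [convolution_precompR_apply _ hf (hc'.fderiv ℝ) (hψ'.continuous_fderiv one_ne_zero)] at h1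
  have hd : ∀ y, fderiv ℝ (fun y => ψ (-y)) y = -fderiv ℝ ψ (-y) := by
    intro y
    have := (hψ.differentiable one_ne_zero (-y)).hasFDerivAt.comp y (hasFDerivAt_id y).neg
    rw [show (fun y => ψ (-y)) = ψ ∘ fun y => -y from rfl]
    rw [HasFDerivAt.fderiv this]
    ext v; simp
  convert! h1 using 1
  · ext s
    simp [convolution_def, neg_sub]
  · simp [convolution_def, hd, neg_sub, integral_neg]

/-- If the weak derivative of `F ∈ Lᵖ` is `D` then `h ↦ F (· + h)` is differentiable at `0`
in `Lᵖ`. -/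
theorem hasFDerivAt_lpTranslate [hp : Fact (1 ≤ p)] (hpt : p ≠ ⊤)
    (F : Lp ℝ p (volume : Measure (EuclideanSpace ℝ (Fin n))))
    (D : EuclideanSpace ℝ (Fin n) →L[ℝ] Lp ℝ p (volume : Measure (EuclideanSpace ℝ (Fin n))))
    (hD : ∀ ψ : EuclideanSpace ℝ (Fin n) → ℝ, ContDiff ℝ ((⊤ : ℕ∞) : WithTop ℕ∞) ψ →
      HasCompactSupport ψ → ∀ h, ∫ x, F x * fderiv ℝ ψ x h = -∫ x, D h x * ψ x) :
    HasFDerivAt (fun h => lpTranslate h F) D 0 := by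
  have hcont : ∀ h (u : Lp ℝ p (volume : Measure (EuclideanSpace ℝ (Fin n)))),
      Continuous fun t : ℝ => lpTranslate (t • h) u := fun h u =>
    (continuous_lpTranslate hpt u).comp (by fun_prop)
  -- Fundamental theorem of calculus along the segment from 0 to h, checked by pairing with ψ: the
  -- derivative falls on the translate of ψ, and `hD` moves it back to `F`.
  have hrep : ∀ h, lpTranslate h F - F = ∫ t in (0 : ℝ)..1, lpTranslate (t • h) (D h) := by
    intro h
    apply Lp.eq_of_forall_integral_mul_eq
    intro ψ hψ hc
    obtain ⟨L, hL⟩ := exists_pairing (p := p) hψ.continuous hc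
    rw [← hL, ← hL, ← L.intervalIntegral_comp_comm ((hcont h _).intervalIntegrable _ _)]
    have hψ1 : ContDiff ℝ 1 ψ := hψ.of_le (by exact_mod_cast le_top)
    have hder : ∀ t : ℝ, HasDerivAt (fun t : ℝ => L (lpTranslate (t • h) F))
        (L (lpTranslate (t • h) (D h))) t := by
      intro t
      simp only [hL, integral_lpTranslate_mul]
      convert! hasDerivAt_integral_mul_comp_sub_smul ((Lp.memLp F).locallyIntegrable hp.out)
        hψ1 hc h t using 1
      have hc2 : HasCompactSupport fun x => ψ (x - t • h) :=
        hc.comp_homeomorph (Homeomorph.subRight (t • h))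
      have hψ2 : ContDiff ℝ ((⊤ : ℕ∞) : WithTop ℕ∞) fun x => ψ (x - t • h) :=
        hψ.comp (contDiff_id.sub contDiff_const)
      rw [← neg_eq_iff_eq_neg, ← hD _ hψ2 hc2 h]
      simp only [fderiv_comp_sub]
    rw [intervalIntegral.integral_eq_sub_of_hasDerivAt (fun t _ => hder t)
      ((L.continuous.comp (hcont h _)).intervalIntegrable _ _)]
    simp [lpTranslate_zero]
  -- Expanding D h in the standard basis makes the estimate uniform in the direction of h: only
  -- continuity of the translates of the finitely many D(e_i) is needed.
  have hbd : ∀ h, lpTranslate h F - F - D h =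
      ∑ i, h i • ∫ t in (0 : ℝ)..1, (lpTranslate (t • h) (D (EuclideanSpace.single i 1))
        - D (EuclideanSpace.single i 1)) := by
    intro h
    have hsum : h = ∑ i, h i • EuclideanSpace.single i (1 : ℝ) := by
      ext j; simp [Finset.sum_apply, Pi.single_apply]
    have hDh : D h = ∑ i, h i • D (EuclideanSpace.single i (1 : ℝ)) := by
      conv_lhs => rw [hsum]
      simp
    rw [hrep]
    simp_rw [fun i => intervalIntegral.integral_sub
      ((hcont h (D (EuclideanSpace.single i 1))).intervalIntegrable 0 1)
      (intervalIntegrable_const (c := D (EuclideanSpace.single i 1)) (μ := volume))]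
    simp only [smul_sub, Finset.sum_sub_distrib, intervalIntegral.integral_const, sub_zero,
      one_smul, ← hDh]
    congr 1
    simp_rw [← intervalIntegral.integral_smul]
    rw [← intervalIntegral.integral_finsetSum
      (fun i _ => (show Continuous fun t : ℝ => h i •
        lpTranslate (t • h) (D (EuclideanSpace.single i 1)) from
          (hcont h _).const_smul (h i)).intervalIntegrable _ _)]
    congr 1
    ext1 t
    rw [hDh]
    simp
  rw [hasFDerivAt_iff_isLittleO_nhds_zero]
  simp only [zero_add, lpTranslate_zero, hbd]
  refine Asymptotics.IsLittleO.fun_sum fun i _ => ?_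
  have h1 : (fun h : EuclideanSpace ℝ (Fin n) => (h i : ℝ)) =O[𝓝 0] fun h => ‖h‖ :=
    Asymptotics.IsBigO.of_bound 1 (Eventually.of_forall fun h => by
      simpa using PiLp.norm_apply_le h i)
  have h2 : (fun h : EuclideanSpace ℝ (Fin n) =>
      ∫ t in (0 : ℝ)..1, (lpTranslate (t • h) (D (EuclideanSpace.single i 1))
        - D (EuclideanSpace.single i 1))) =o[𝓝 0] fun _ => (1 : ℝ) := by
    rw [Asymptotics.isLittleO_one_iff, Metric.tendsto_nhds_nhds]
    intro ε hε
    have hc0 := (continuous_lpTranslate hpt (D (EuclideanSpace.single i 1))).tendsto 0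
    rw [lpTranslate_zero, Metric.tendsto_nhds_nhds] at hc0
    obtain ⟨δ, hδ, hδ'⟩ := hc0 (ε / 2) (by positivity)
    refine ⟨δ, hδ, fun {h} hh => ?_⟩
    rw [dist_zero_right] at hh ⊢
    refine lt_of_le_of_lt (intervalIntegral.norm_integral_le_of_norm_le_const (C := ε / 2) ?_) ?_
    · intro t ht
      rw [uIoc_of_le zero_le_one] at ht
      rw [← dist_eq_norm]
      refine (hδ' ?_).le
      rw [dist_zero_right, norm_smul, Real.norm_of_nonneg ht.1.le]
      nlinarith [norm_nonneg h, ht.2]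
    · norm_num; linarith
  exact Asymptotics.IsLittleO.of_norm_right (by simpa using h1.smul_isLittleO h2)

end Translation

/-! ### Integrability and moments of the kernel h_i / |h|^{n+α+1}. -/

section Kernel

variable {n : ℕ}

/-- Polar coordinates; n times the volume of the unit ball is the area of the unit sphere. -/
theorem integrableOn_norm_preimage_rpow (hn : 1 ≤ n) {S : Set ℝ} (hS : MeasurableSet S)
    (hS0 : S ⊆ Ioi 0) {r : ℝ} (h : IntegrableOn (fun y : ℝ => y ^ ((n : ℝ) - 1 + r)) S) :
    IntegrableOn (fun x : EuclideanSpace ℝ (Fin n) => ‖x‖ ^ r) (norm ⁻¹' S) ∧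
      ∫ x in norm ⁻¹' S, ‖(x : EuclideanSpace ℝ (Fin n))‖ ^ r =
        n * (volume.real (Metric.ball (0 : EuclideanSpace ℝ (Fin n)) 1) *
          ∫ y in S, y ^ ((n : ℝ) - 1 + r)) := by
  have : Nonempty (Fin n) := ⟨⟨0, hn⟩⟩
  have hSn : MeasurableSet (norm ⁻¹' S : Set (EuclideanSpace ℝ (Fin n))) := measurable_norm hS
  have e1 : (norm ⁻¹' S : Set (EuclideanSpace ℝ (Fin n))).indicator (fun x => ‖x‖ ^ r) =
      fun x => S.indicator (fun y : ℝ => y ^ r) ‖x‖ := by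
    classical
    ext x; simp only [indicator_apply, mem_preimage]
  have e2 : EqOn (fun y : ℝ => y ^ (n - 1) • S.indicator (fun y : ℝ => y ^ r) y)
      (S.indicator fun y : ℝ => y ^ ((n : ℝ) - 1 + r)) (Ioi 0) := by
    intro y hy
    by_cases hyS : y ∈ S
    · simp only [indicator_of_mem hyS, smul_eq_mul]
      rw [Real.rpow_add hy, show (n : ℝ) - 1 = ((n - 1 : ℕ) : ℝ) by push_cast [hn]; ring,
        Real.rpow_natCast]
    · simp [hyS]
  constructor
  · rw [← integrable_indicator_iff hSn, e1,
      integrable_fun_norm_addHaar volume (f := S.indicator fun y : ℝ => y ^ r),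
      finrank_euclideanSpace_fin, integrableOn_congr_fun e2 measurableSet_Ioi]
    exact ((integrable_indicator_iff hS).2 h).integrableOn
  · rw [← integral_indicator hSn, e1,
      integral_fun_norm_addHaar volume (S.indicator fun y : ℝ => y ^ r),
      finrank_euclideanSpace_fin, setIntegral_congr_fun measurableSet_Ioi e2,
      setIntegral_indicator hS, inter_eq_right.2 hS0, nsmul_eq_mul, smul_eq_mul]

theorem integrableOn_ball_rpow (hn : 1 ≤ n) {α δ : ℝ} (hα : α < 1) (hδ : 0 < δ) :
    IntegrableOn (fun x : EuclideanSpace ℝ (Fin n) => ‖x‖ ^ (1 - n - α)) (Metric.ball 0 δ) ∧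
      ∫ x in Metric.ball (0 : EuclideanSpace ℝ (Fin n)) δ, ‖x‖ ^ (1 - n - α) =
        n * (volume.real (Metric.ball (0 : EuclideanSpace ℝ (Fin n)) 1) *
          (δ ^ (1 - α) / (1 - α))) := by
  have : Nonempty (Fin n) := ⟨⟨0, hn⟩⟩
  have hexp : (n : ℝ) - 1 + (1 - n - α) = -α := by ring
  -- The radial formula needs positive radii, so the origin, a null set as n ≥ 1, is removed from
  -- the ball.
  have hset : (norm ⁻¹' Ioo 0 δ : Set (EuclideanSpace ℝ (Fin n))) =ᵐ[volume]
      Metric.ball 0 δ := by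
    have h0 : ∀ᵐ x : EuclideanSpace ℝ (Fin n), x ≠ 0 := by
      simp [ae_iff]
    filter_upwards [h0] with x hx
    refine propext ?_
    change ‖x‖ ∈ Ioo 0 δ ↔ x ∈ Metric.ball 0 δ
    simp [hx]
  have hI : IntegrableOn (fun y : ℝ => y ^ (-α)) (Ioo 0 δ) := by
    rw [intervalIntegral.integrableOn_Ioo_rpow_iff hδ]; linarith
  obtain ⟨h1, h2⟩ := integrableOn_norm_preimage_rpow (n := n) hn measurableSet_Ioo
    (Ioo_subset_Ioi_self) (r := 1 - n - α) (by rwa [hexp])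
  refine ⟨(integrableOn_congr_set_ae hset).1 h1, ?_⟩
  rw [← setIntegral_congr_set hset, h2, hexp, ← integral_Ioc_eq_integral_Ioo,
    ← intervalIntegral.integral_of_le hδ.le, integral_rpow (Or.inl (by linarith)),
    Real.zero_rpow (by linarith)]
  ring_nf

theorem integrableOn_compl_ball_rpow (hn : 1 ≤ n) {α δ : ℝ} (hα : 0 < α) (hδ : 0 < δ) :
    IntegrableOn (fun x : EuclideanSpace ℝ (Fin n) => ‖x‖ ^ (-n - α)) (Metric.ball 0 δ)ᶜ ∧
      ∫ x in (Metric.ball (0 : EuclideanSpace ℝ (Fin n)) δ)ᶜ, ‖x‖ ^ (-n - α) =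
        n * (volume.real (Metric.ball (0 : EuclideanSpace ℝ (Fin n)) 1) *
          (δ ^ (-α) / α)) := by
  have hexp : (n : ℝ) - 1 + (-n - α) = -α - 1 := by ring
  have hset : (norm ⁻¹' Ici δ : Set (EuclideanSpace ℝ (Fin n))) = (Metric.ball 0 δ)ᶜ := by
    ext x; simp
  have hI : IntegrableOn (fun y : ℝ => y ^ (-α - 1)) (Ici δ) := by
    rw [integrableOn_Ici_iff_integrableOn_Ioi]
    exact integrableOn_Ioi_rpow_of_lt (by linarith) hδ
  obtain ⟨h1, h2⟩ := integrableOn_norm_preimage_rpow (n := n) hn measurableSet_Ici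
    (fun y hy => hδ.trans_le hy) (r := -n - α) (by rwa [hexp])
  rw [hset] at h1 h2
  refine ⟨h1, ?_⟩
  rw [h2, hexp, integral_Ici_eq_integral_Ioi, integral_Ioi_rpow_of_lt (by linarith) hδ]
  rw [show -α - 1 + 1 = -α by ring, neg_div_neg_eq]

theorem setIntegral_ball_comp_linearIsometryEquiv (δ : ℝ)
    (e : EuclideanSpace ℝ (Fin n) ≃ₗᵢ[ℝ] EuclideanSpace ℝ (Fin n))
    (f : EuclideanSpace ℝ (Fin n) → ℝ) :
    ∫ x in Metric.ball 0 δ, f (e x) = ∫ x in Metric.ball 0 δ, f x := by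
  have h := e.measurePreserving.setIntegral_preimage_emb
    e.toHomeomorph.measurableEmbedding f (Metric.ball 0 δ)
  have hset : e ⁻¹' Metric.ball 0 δ = Metric.ball 0 δ := by
    ext x; simp
  rwa [hset] at h

theorem norm_coord_div_rpow_smul_le {X : Type*} [NormedAddCommGroup X] [NormedSpace ℝ X]
    (h : EuclideanSpace ℝ (Fin n)) (i : Fin n) (α : ℝ) (u : X) :
    ‖(h i / ‖h‖ ^ ((n : ℝ) + α + 1)) • u‖ ≤ ‖h‖ ^ (-n - α) * ‖u‖ := by
  rw [norm_smul]
  refine mul_le_mul_of_nonneg_right ?_ (norm_nonneg _)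
  rcases eq_or_ne h 0 with rfl | hh
  · simp only [PiLp.zero_apply, zero_div, norm_zero]; positivity
  · have hpos : 0 < ‖h‖ := norm_pos_iff.2 hh
    rw [norm_div, Real.norm_of_nonneg (Real.rpow_nonneg hpos.le _),
      div_le_iff₀ (Real.rpow_pos_of_pos hpos _), ← Real.rpow_add hpos,
      show -(n : ℝ) - α + (n + α + 1) = 1 by ring, Real.rpow_one]
    exact PiLp.norm_apply_le h i

theorem norm_coord_div_rpow_smul_le_of_le {X : Type*} [NormedAddCommGroup X] [NormedSpace ℝ X]
    (h : EuclideanSpace ℝ (Fin n)) (i : Fin n) (α : ℝ) {u : X} {C : ℝ} (hC : 0 ≤ C)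
    (hu : ‖u‖ ≤ C * ‖h‖) :
    ‖(h i / ‖h‖ ^ ((n : ℝ) + α + 1)) • u‖ ≤ C * ‖h‖ ^ (1 - n - α) := by
  rcases eq_or_ne h 0 with rfl | hh
  · simp only [PiLp.zero_apply, zero_div, zero_smul, norm_zero]; positivity
  · have hpos : 0 < ‖h‖ := norm_pos_iff.2 hh
    refine (norm_coord_div_rpow_smul_le h i α u).trans ?_
    calc ‖h‖ ^ (-n - α) * ‖u‖ ≤ ‖h‖ ^ (-n - α) * (C * ‖h‖) := by gcongr
      _ = C * (‖h‖ ^ (-n - α) * ‖h‖ ^ (1 : ℝ)) := by rw [Real.rpow_one]; ring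
      _ = C * ‖h‖ ^ (1 - n - α) := by rw [← Real.rpow_add hpos]; ring_nf

theorem measurable_coord_div_rpow (i : Fin n) (α : ℝ) :
    Measurable fun h : EuclideanSpace ℝ (Fin n) => h i / ‖h‖ ^ ((n : ℝ) + α + 1) := by
  fun_prop

theorem integrableOn_coord_smul_ball {X : Type*} [NormedAddCommGroup X] [NormedSpace ℝ X]
    (hn : 1 ≤ n) {α δ : ℝ} (hα : α < 1) (hδ : 0 < δ) (i : Fin n)
    {Ψ : EuclideanSpace ℝ (Fin n) → X} (hΨ : AEStronglyMeasurable Ψ volume) {C : ℝ} (hC : 0 ≤ C)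
    (hb : ∀ h ∈ Metric.ball (0 : EuclideanSpace ℝ (Fin n)) δ, ‖Ψ h‖ ≤ C * ‖h‖) :
    IntegrableOn (fun h => (h i / ‖h‖ ^ ((n : ℝ) + α + 1)) • Ψ h) (Metric.ball 0 δ) ∧
      ‖∫ h in Metric.ball 0 δ, (h i / ‖h‖ ^ ((n : ℝ) + α + 1)) • Ψ h‖ ≤
        C * (n * (volume.real (Metric.ball (0 : EuclideanSpace ℝ (Fin n)) 1) *
          (δ ^ (1 - α) / (1 - α)))) := by
  obtain ⟨h1, h2⟩ := integrableOn_ball_rpow hn hα hδ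
  have hae : ∀ᵐ h ∂volume.restrict (Metric.ball (0 : EuclideanSpace ℝ (Fin n)) δ),
      ‖(h i / ‖h‖ ^ ((n : ℝ) + α + 1)) • Ψ h‖ ≤ C * ‖h‖ ^ (1 - n - α) :=
    (ae_restrict_mem measurableSet_ball).mono fun h hh =>
      norm_coord_div_rpow_smul_le_of_le h i α hC (hb h hh)
  refine ⟨(h1.const_mul C).mono' ((measurable_coord_div_rpow i α).aestronglyMeasurable.smul
    hΨ.restrict) hae, ?_⟩
  rw [← h2, ← integral_const_mul]
  exact norm_integral_le_of_norm_le (h1.const_mul C) hae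

theorem integrableOn_coord_smul_compl_ball {X : Type*} [NormedAddCommGroup X] [NormedSpace ℝ X]
    (hn : 1 ≤ n) {α δ : ℝ} (hα : 0 < α) (hδ : 0 < δ) (i : Fin n)
    {Ψ : EuclideanSpace ℝ (Fin n) → X} (hΨ : AEStronglyMeasurable Ψ volume) {M : ℝ}
    (hb : ∀ h, ‖Ψ h‖ ≤ M) :
    IntegrableOn (fun h => (h i / ‖h‖ ^ ((n : ℝ) + α + 1)) • Ψ h) (Metric.ball 0 δ)ᶜ ∧
      ‖∫ h in (Metric.ball 0 δ)ᶜ, (h i / ‖h‖ ^ ((n : ℝ) + α + 1)) • Ψ h‖ ≤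
        M * (n * (volume.real (Metric.ball (0 : EuclideanSpace ℝ (Fin n)) 1) *
          (δ ^ (-α) / α))) := by
  obtain ⟨h1, h2⟩ := integrableOn_compl_ball_rpow hn hα hδ
  have hae : ∀ᵐ h ∂volume.restrict (Metric.ball (0 : EuclideanSpace ℝ (Fin n)) δ)ᶜ,
      ‖(h i / ‖h‖ ^ ((n : ℝ) + α + 1)) • Ψ h‖ ≤ M * ‖h‖ ^ (-n - α) :=
    Eventually.of_forall fun h => (norm_coord_div_rpow_smul_le h i α _).trans (by
      rw [mul_comm]; gcongr; exact hb h)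
  refine ⟨(h1.const_mul M).mono' ((measurable_coord_div_rpow i α).aestronglyMeasurable.smul
    hΨ.restrict) hae, ?_⟩
  rw [← h2, ← integral_const_mul]
  exact norm_integral_le_of_norm_le (h1.const_mul M) hae

theorem integrableOn_ball_coord_mul_coord (hn : 1 ≤ n) {α δ : ℝ} (hα : α < 1) (hδ : 0 < δ)
    (i j : Fin n) :
    IntegrableOn (fun h : EuclideanSpace ℝ (Fin n) => h i / ‖h‖ ^ ((n : ℝ) + α + 1) * h j)
      (Metric.ball 0 δ) :=
  (integrableOn_coord_smul_ball hn hα hδ i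
    (Ψ := fun h : EuclideanSpace ℝ (Fin n) => (h j : ℝ))
    (Continuous.aestronglyMeasurable (by fun_prop)) zero_le_one
      fun h _ => by simpa using PiLp.norm_apply_le h j).1

/-- Flipping the sign of the i-th coordinate preserves the ball and negates the integrand. -/
theorem setIntegral_ball_coord_mul_coord_of_ne {α δ : ℝ} {i j : Fin n} (hij : i ≠ j) :
    ∫ h in Metric.ball (0 : EuclideanSpace ℝ (Fin n)) δ,
      h i / ‖h‖ ^ ((n : ℝ) + α + 1) * h j = 0 := by
  have key := setIntegral_ball_comp_linearIsometryEquiv δ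
    (LinearIsometryEquiv.piLpCongrRight 2 fun k : Fin n =>
      if k = i then LinearIsometryEquiv.neg ℝ (E := ℝ) else LinearIsometryEquiv.refl ℝ ℝ)
    (fun h => h i / ‖h‖ ^ ((n : ℝ) + α + 1) * h j)
  simp only [LinearIsometryEquiv.norm_map] at key
  simp only [LinearIsometryEquiv.piLpCongrRight_apply, if_true,
    if_neg hij.symm, LinearIsometryEquiv.coe_neg, LinearIsometryEquiv.coe_refl, id, neg_div,
    neg_mul, integral_neg] at key
  linarith

/-- Swapping two coordinates is an isometry. -/
theorem setIntegral_ball_coord_mul_self_eq (α δ : ℝ) (i j : Fin n) :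
    ∫ h in Metric.ball (0 : EuclideanSpace ℝ (Fin n)) δ, h i / ‖h‖ ^ ((n : ℝ) + α + 1) * h i =
      ∫ h in Metric.ball (0 : EuclideanSpace ℝ (Fin n)) δ,
        h j / ‖h‖ ^ ((n : ℝ) + α + 1) * h j := by
  have key := setIntegral_ball_comp_linearIsometryEquiv δ
    (LinearIsometryEquiv.piLpCongrLeft 2 ℝ ℝ (Equiv.swap i j))
    (fun h => h i / ‖h‖ ^ ((n : ℝ) + α + 1) * h i)
  simpa only [LinearIsometryEquiv.norm_map, LinearIsometryEquiv.piLpCongrLeft_apply,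
    Equiv.piCongrLeft'_apply, Equiv.symm_swap, Equiv.swap_apply_left] using key.symm

/-- The n diagonal moments are equal and sum to the integral of |h|^{1-n-α}, so each is 1/n of it.
-/
theorem setIntegral_ball_coord_mul_self (hn : 1 ≤ n) {α δ : ℝ} (hα : α < 1) (hδ : 0 < δ)
    (i : Fin n) :
    ∫ h in Metric.ball (0 : EuclideanSpace ℝ (Fin n)) δ, h i / ‖h‖ ^ ((n : ℝ) + α + 1) * h i =
      volume.real (Metric.ball (0 : EuclideanSpace ℝ (Fin n)) 1) * (δ ^ (1 - α) / (1 - α)) := by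
  have hsum : ∑ j, ∫ h in Metric.ball (0 : EuclideanSpace ℝ (Fin n)) δ,
      h j / ‖h‖ ^ ((n : ℝ) + α + 1) * h j =
      ∫ h in Metric.ball (0 : EuclideanSpace ℝ (Fin n)) δ, ‖h‖ ^ (1 - n - α) := by
    rw [← integral_finsetSum _ fun j _ => integrableOn_ball_coord_mul_coord hn hα hδ j j]
    have : Nonempty (Fin n) := ⟨⟨0, hn⟩⟩
    have h0 : ∀ᵐ x : EuclideanSpace ℝ (Fin n), x ≠ 0 := by simp [ae_iff]
    refine integral_congr_ae (ae_restrict_of_ae ?_)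
    filter_upwards [h0] with h hh
    have hpos : 0 < ‖h‖ := norm_pos_iff.2 hh
    have hsq : ∑ j, h j * h j = ‖h‖ ^ (2 : ℝ) := by
      rw [Real.rpow_two, EuclideanSpace.real_norm_sq_eq]
      simp [sq]
    calc ∑ j, h j / ‖h‖ ^ ((n : ℝ) + α + 1) * h j
        = (∑ j, h j * h j) / ‖h‖ ^ ((n : ℝ) + α + 1) := by
          rw [Finset.sum_div]; exact Finset.sum_congr rfl fun j _ => by ring
      _ = ‖h‖ ^ (1 - n - α) := by
          rw [hsq, ← Real.rpow_sub hpos]; ring_nf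
  rw [Finset.sum_congr rfl fun j _ => setIntegral_ball_coord_mul_self_eq α δ j i,
    (integrableOn_ball_rpow hn hα hδ).2] at hsum
  have hn0 : (n : ℝ) ≠ 0 := by positivity
  simp only [Finset.sum_const, Finset.card_univ, Fintype.card_fin, nsmul_eq_mul] at hsum
  exact mul_left_cancel₀ hn0 hsum

theorem setIntegral_ball_coord_smul_clm {X : Type*} [NormedAddCommGroup X] [NormedSpace ℝ X]
    [CompleteSpace X]
    (hn : 1 ≤ n) {α δ : ℝ} (hα : α < 1) (hδ : 0 < δ) (i : Fin n)
    (D : EuclideanSpace ℝ (Fin n) →L[ℝ] X) :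
    ∫ h in Metric.ball (0 : EuclideanSpace ℝ (Fin n)) δ,
      (h i / ‖h‖ ^ ((n : ℝ) + α + 1)) • D h =
      (volume.real (Metric.ball (0 : EuclideanSpace ℝ (Fin n)) 1) * (δ ^ (1 - α) / (1 - α))) •
        D (EuclideanSpace.single i 1) := by
  have hD : ∀ h, D h = ∑ j, h j • D (EuclideanSpace.single j (1 : ℝ)) := by
    intro h
    have hsum : h = ∑ j, h j • EuclideanSpace.single j (1 : ℝ) := by
      ext j; simp [Finset.sum_apply, Pi.single_apply]
    conv_lhs => rw [hsum]
    simp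
  have hfun : (fun h : EuclideanSpace ℝ (Fin n) => (h i / ‖h‖ ^ ((n : ℝ) + α + 1)) • D h) =
      fun h => ∑ j, (h i / ‖h‖ ^ ((n : ℝ) + α + 1) * h j) • D (EuclideanSpace.single j 1) := by
    ext1 h
    rw [hD h, Finset.smul_sum]
    simp only [smul_smul]
  rw [hfun, integral_finsetSum _ fun j _ =>
    (integrableOn_ball_coord_mul_coord hn hα hδ i j).smul_const _]
  simp_rw [integral_smul_const]
  rw [Finset.sum_eq_single i (fun j _ hj => by
    rw [setIntegral_ball_coord_mul_coord_of_ne hj.symm, zero_smul]) (by simp),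
    setIntegral_ball_coord_mul_self hn hα hδ]

/-! ### Behaviour of μ_{n,α} as α → 1⁻. -/

/-- Γ(s + 1) = s Γ(s) at s = (1 - α)/2 exposes the factor 1 - α, which cancels the blow-up of the
second moments. -/
theorem fracConst_eq_mul (n : ℕ) {α : ℝ} (hα : α < 1) :
    fracConst n α = (2 : ℝ) ^ α * Real.pi ^ (-((n : ℝ) / 2)) *
      (Real.Gamma (((n : ℝ) + α + 1) / 2) / (2 * Real.Gamma ((1 - α) / 2 + 1))) * (1 - α) := by
  have h0 : (1 - α) / 2 ≠ 0 := by linarith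
  have h1 : Real.Gamma ((1 - α) / 2) ≠ 0 := (Real.Gamma_pos_of_pos (by linarith)).ne'
  have h2 : 1 - α ≠ 0 := by linarith
  rw [fracConst, Real.Gamma_add_one h0]
  field_simp

theorem tendsto_fracConst_div_sub (n : ℕ) :
    Tendsto (fun α => (2 : ℝ) ^ α * Real.pi ^ (-((n : ℝ) / 2)) *
      (Real.Gamma (((n : ℝ) + α + 1) / 2) / (2 * Real.Gamma ((1 - α) / 2 + 1)))) (𝓝[<] 1)
      (𝓝 (Real.pi ^ (-((n : ℝ) / 2)) * Real.Gamma ((n : ℝ) / 2 + 1))) := by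
  refine Tendsto.mono_left ?_ nhdsWithin_le_nhds
  have hG : ∀ {x : ℝ}, 0 < x → ContinuousAt Real.Gamma x := fun {x} hx =>
    (Real.differentiableAt_Gamma fun m => by
      have : (0 : ℝ) ≤ m := m.cast_nonneg
      linarith).continuousAt
  have h1 : Tendsto (fun α : ℝ => Real.Gamma (((n : ℝ) + α + 1) / 2)) (𝓝 1)
      (𝓝 (Real.Gamma ((n : ℝ) / 2 + 1))) := by
    refine (hG (by positivity)).tendsto.comp ?_
    exact Continuous.tendsto' (by fun_prop) _ _ (by ring)
  have h2 : Tendsto (fun α : ℝ => Real.Gamma ((1 - α) / 2 + 1)) (𝓝 1) (𝓝 (Real.Gamma 1)) := by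
    refine (hG one_pos).tendsto.comp ?_
    exact Continuous.tendsto' (by fun_prop) _ _ (by ring)
  have h3 : Tendsto (fun α : ℝ => (2 : ℝ) ^ α) (𝓝 1) (𝓝 (2 ^ (1 : ℝ))) :=
    (Real.continuous_const_rpow two_ne_zero).tendsto 1
  rw [Real.Gamma_one] at h2
  have := (h3.mul_const (Real.pi ^ (-((n : ℝ) / 2)))).mul
    (h1.div (h2.const_mul 2) (by norm_num))
  rw [Real.rpow_one] at this
  convert! this using 2
  ring

/-- The limit of μ_{n,α}/(1 - α) is thus 1/|B₁|, which normalises the second moments. -/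
theorem volume_real_ball_mul (hn : 1 ≤ n) :
    Real.pi ^ (-((n : ℝ) / 2)) * Real.Gamma ((n : ℝ) / 2 + 1) *
      volume.real (Metric.ball (0 : EuclideanSpace ℝ (Fin n)) 1) = 1 := by
  have : Nonempty (Fin n) := ⟨⟨0, hn⟩⟩
  have hG : 0 < Real.Gamma ((n : ℝ) / 2 + 1) := Real.Gamma_pos_of_pos (by positivity)
  rw [Measure.real, EuclideanSpace.volume_ball, Fintype.card_fin, ENNReal.ofReal_one, one_pow,
    one_mul, ENNReal.toReal_ofReal (by positivity), Real.sqrt_eq_rpow, ← Real.rpow_natCast,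
    ← Real.rpow_mul Real.pi_pos.le, Real.rpow_neg Real.pi_pos.le,
    show 1 / 2 * (n : ℝ) = n / 2 by ring]
  have : Real.pi ^ ((n : ℝ) / 2) ≠ 0 := by positivity
  field_simp

theorem tendsto_fracConst_mul_div (hn : 1 ≤ n) {δ : ℝ} (hδ : 0 < δ) :
    Tendsto (fun α => fracConst n α *
      (volume.real (Metric.ball (0 : EuclideanSpace ℝ (Fin n)) 1) * (δ ^ (1 - α) / (1 - α))))
      (𝓝[<] 1) (𝓝 1) := by
  have h1 : Tendsto (fun α : ℝ => δ ^ (1 - α)) (𝓝[<] 1) (𝓝 1) := by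
    refine Tendsto.mono_left ?_ nhdsWithin_le_nhds
    exact Continuous.tendsto' ((Real.continuous_const_rpow hδ.ne').comp (by fun_prop)) _ _
      (by simp)
  have := ((tendsto_fracConst_div_sub n).mul_const
    (volume.real (Metric.ball (0 : EuclideanSpace ℝ (Fin n)) 1))).mul h1
  rw [volume_real_ball_mul hn, one_mul] at this
  refine this.congr' ?_
  filter_upwards [self_mem_nhdsWithin] with α hα
  have : 1 - α ≠ 0 := (sub_pos.2 hα).ne'
  rw [fracConst_eq_mul n hα]
  field_simp

theorem tendsto_fracConst (n : ℕ) : Tendsto (fracConst n) (𝓝[<] 1) (𝓝 0) := by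
  have h1 : Tendsto (fun α : ℝ => 1 - α) (𝓝[<] 1) (𝓝 0) := by
    refine Tendsto.mono_left ?_ nhdsWithin_le_nhds
    exact Continuous.tendsto' (by fun_prop) _ _ (by simp)
  have := (tendsto_fracConst_div_sub n).mul h1
  rw [mul_zero] at this
  refine this.congr' ?_
  filter_upwards [self_mem_nhdsWithin] with α hα
  rw [fracConst_eq_mul n hα]

/-! ### Concentration of the kernel at 0 for Banach-valued maps. -/

variable {X : Type*} [NormedAddCommGroup X] [NormedSpace ℝ X]
  {Ψ : EuclideanSpace ℝ (Fin n) → X} {D : EuclideanSpace ℝ (Fin n) →L[ℝ] X} {M : ℝ}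

theorem HasFDerivAt.exists_ball_norm_sub_le (hD : HasFDerivAt Ψ D 0) (h0 : Ψ 0 = 0) {ε : ℝ}
    (hε : 0 < ε) :
    ∃ δ > 0, ∀ h ∈ Metric.ball (0 : EuclideanSpace ℝ (Fin n)) δ, ‖Ψ h - D h‖ ≤ ε * ‖h‖ := by
  rw [hasFDerivAt_iff_isLittleO_nhds_zero] at hD
  simp only [zero_add, h0, sub_zero] at hD
  exact Metric.eventually_nhds_iff_ball.1 (hD.bound hε)

theorem integrable_coord_smul (hn : 1 ≤ n) {α : ℝ} (hα : α ∈ Ioo (0 : ℝ) 1) (i : Fin n)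
    (hΨ : AEStronglyMeasurable Ψ volume) (hb : ∀ h, ‖Ψ h‖ ≤ M) {C δ : ℝ} (hC : 0 ≤ C) (hδ : 0 < δ)
    (hball : ∀ h ∈ Metric.ball (0 : EuclideanSpace ℝ (Fin n)) δ, ‖Ψ h‖ ≤ C * ‖h‖) :
    Integrable fun h => (h i / ‖h‖ ^ ((n : ℝ) + α + 1)) • Ψ h := by
  rw [← integrableOn_univ, ← union_compl_self (Metric.ball (0 : EuclideanSpace ℝ (Fin n)) δ)]
  exact (integrableOn_coord_smul_ball hn hα.2 hδ i hΨ hC hball).1.union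
    (integrableOn_coord_smul_compl_ball hn hα.1 hδ i hΨ hb).1

/-- A bounded continuous function that is differentiable at `0` and vanishes there is integrable
against the kernel of the fractional gradient. -/
theorem HasFDerivAt.integrable_coord_smul (hD : HasFDerivAt Ψ D 0) (hn : 1 ≤ n) {α : ℝ}
    (hα : α ∈ Ioo (0 : ℝ) 1) (i : Fin n)
    (hΨ : Continuous Ψ) (hb : ∀ h, ‖Ψ h‖ ≤ M) (h0 : Ψ 0 = 0) :
    Integrable fun h => (h i / ‖h‖ ^ ((n : ℝ) + α + 1)) • Ψ h := by
  obtain ⟨δ, hδ, hδ'⟩ := hD.exists_ball_norm_sub_le h0 one_pos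
  refine _root_.integrable_coord_smul hn hα i hΨ.aestronglyMeasurable hb (C := 1 + ‖D‖)
    (by positivity) hδ fun h hh => ?_
  have h1 := norm_add_le (Ψ h - D h) (D h)
  rw [sub_add_cancel] at h1
  have h2 := hδ' h hh
  have h3 := D.le_opNorm h
  linarith

/-- The three terms are the error of replacing Ψ by D in the ball, the error in the normalisation of
the second moment, and the tail outside the ball. -/
theorem norm_fracConst_smul_integral_sub_le [CompleteSpace X] (hn : 1 ≤ n) {α : ℝ}
    (hα : α ∈ Ioo (0 : ℝ) 1) (i : Fin n)
    (hΨ : Continuous Ψ) (hb : ∀ h, ‖Ψ h‖ ≤ M) (h0 : Ψ 0 = 0) (hD : HasFDerivAt Ψ D 0)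
    {ε δ : ℝ} (hε : 0 ≤ ε) (hδ : 0 < δ)
    (hε' : ∀ h ∈ Metric.ball (0 : EuclideanSpace ℝ (Fin n)) δ, ‖Ψ h - D h‖ ≤ ε * ‖h‖) :
    ‖fracConst n α • (∫ h, (h i / ‖h‖ ^ ((n : ℝ) + α + 1)) • Ψ h) -
        D (EuclideanSpace.single i 1)‖ ≤
      ε * n * |fracConst n α *
        (volume.real (Metric.ball (0 : EuclideanSpace ℝ (Fin n)) 1) * (δ ^ (1 - α) / (1 - α)))| +
      |fracConst n α * (volume.real (Metric.ball (0 : EuclideanSpace ℝ (Fin n)) 1) *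
        (δ ^ (1 - α) / (1 - α))) - 1| * ‖D (EuclideanSpace.single i 1)‖ +
      |fracConst n α| * (M * (n * (volume.real (Metric.ball (0 : EuclideanSpace ℝ (Fin n)) 1) *
          (δ ^ (-α) / α)))) := by
  obtain ⟨hR, hR'⟩ := integrableOn_coord_smul_ball hn hα.2 hδ i
    (Ψ := fun h => Ψ h - D h) (hΨ.sub D.continuous).aestronglyMeasurable hε hε'
  obtain ⟨-, hF⟩ := integrableOn_coord_smul_compl_ball hn hα.1 hδ i hΨ.aestronglyMeasurable hb
  have hDi : IntegrableOn (fun h => (h i / ‖h‖ ^ ((n : ℝ) + α + 1)) • D h) (Metric.ball 0 δ) :=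
    (integrableOn_coord_smul_ball hn hα.2 hδ i D.continuous.aestronglyMeasurable (norm_nonneg D)
      fun h _ => D.le_opNorm h).1
  have hsplit : ∫ h in Metric.ball 0 δ, (h i / ‖h‖ ^ ((n : ℝ) + α + 1)) • Ψ h =
      (∫ h in Metric.ball 0 δ, (h i / ‖h‖ ^ ((n : ℝ) + α + 1)) • (Ψ h - D h)) +
      ∫ h in Metric.ball 0 δ, (h i / ‖h‖ ^ ((n : ℝ) + α + 1)) • D h := by
    rw [← integral_add hR hDi]
    simp only [← smul_add, sub_add_cancel]
  rw [← integral_add_compl measurableSet_ball (hD.integrable_coord_smul hn hα i hΨ hb h0), hsplit,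
    setIntegral_ball_coord_smul_clm hn hα.2 hδ]
  set c := volume.real (Metric.ball (0 : EuclideanSpace ℝ (Fin n)) 1) * (δ ^ (1 - α) / (1 - α))
    with hc
  have hc0 : 0 ≤ c := by
    have := sub_pos.2 hα.2
    positivity
  set A := ∫ h in Metric.ball 0 δ, (h i / ‖h‖ ^ ((n : ℝ) + α + 1)) • (Ψ h - D h)
  set B := ∫ h in (Metric.ball 0 δ)ᶜ, (h i / ‖h‖ ^ ((n : ℝ) + α + 1)) • Ψ h
  set κ := fracConst n α
  set d := D (EuclideanSpace.single i 1)
  calc ‖κ • (A + c • d + B) - d‖ = ‖κ • A + (κ * c - 1) • d + κ • B‖ := by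
        congr 1; module
    _ ≤ |κ| * ‖A‖ + |κ * c - 1| * ‖d‖ + |κ| * ‖B‖ := by
        refine (norm_add₃_le).trans_eq ?_
        simp only [norm_smul, Real.norm_eq_abs]
    _ ≤ |κ| * (ε * (n * c)) + |κ * c - 1| * ‖d‖ + |κ| * (M * (n * (volume.real
          (Metric.ball (0 : EuclideanSpace ℝ (Fin n)) 1) * (δ ^ (-α) / α)))) := by gcongr
    _ = _ := by rw [abs_mul, abs_of_nonneg hc0]; ring

theorem tendsto_fracConst_smul_integral [CompleteSpace X] (hn : 1 ≤ n) (i : Fin n)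
    (hΨ : Continuous Ψ) (hb : ∀ h, ‖Ψ h‖ ≤ M) (h0 : Ψ 0 = 0) (hD : HasFDerivAt Ψ D 0) :
    Tendsto (fun α => fracConst n α • ∫ h, (h i / ‖h‖ ^ ((n : ℝ) + α + 1)) • Ψ h) (𝓝[<] 1)
      (𝓝 (D (EuclideanSpace.single i 1))) := by
  rw [tendsto_iff_norm_sub_tendsto_zero]
  refine (tendsto_order.2 ⟨fun a ha => Eventually.of_forall fun _ => ha.trans_le (norm_nonneg _),
    fun η hη => ?_⟩)
  -- With this ε the linearisation error tends to η/2, while the other two terms tend to 0 once δ is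
  -- fixed.
  have hε : 0 < η / (2 * n) := by positivity
  obtain ⟨δ, hδ, hδ'⟩ := hD.exists_ball_norm_sub_le h0 hε
  have t1 := tendsto_fracConst_mul_div hn hδ
  have t2 : Tendsto (fun α : ℝ => δ ^ (-α) / α) (𝓝[<] 1) (𝓝 (δ ^ (-(1 : ℝ)) / 1)) := by
    refine Tendsto.mono_left ?_ nhdsWithin_le_nhds
    exact (((Real.continuous_const_rpow hδ.ne').comp continuous_neg).tendsto 1).div
      tendsto_id one_ne_zero
  have t3 := ((t1.abs.const_mul (η / (2 * n) * n)).add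
    ((t1.sub_const 1).abs.mul_const ‖D (EuclideanSpace.single i 1)‖)).add
    ((tendsto_fracConst n).abs.mul (((t2.const_mul
      (volume.real (Metric.ball (0 : EuclideanSpace ℝ (Fin n)) 1))).const_mul (n : ℝ)).const_mul M))
  have hlim : η / (2 * n) * n * |(1 : ℝ)| + |(1 : ℝ) - 1| * ‖D (EuclideanSpace.single i 1)‖ +
      |(0 : ℝ)| * (M * (n * (volume.real (Metric.ball (0 : EuclideanSpace ℝ (Fin n)) 1) *
        (δ ^ (-(1 : ℝ)) / 1)))) < η := by
    have : (n : ℝ) ≠ 0 := by positivity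
    rw [sub_self, abs_zero, zero_mul, zero_mul, add_zero, add_zero, abs_one, mul_one]
    field_simp
    linarith
  filter_upwards [t3.eventually_lt_const hlim, Ioo_mem_nhdsLT (zero_lt_one' ℝ)] with α h1 h2
  exact (norm_fracConst_smul_integral_sub_le hn h2 i hΨ hb h0 hD hε.le hδ hδ').trans_lt h1

end Kernel

/-! ### Duality with the fractional divergence. -/

section WeakFormulation

variable {n : ℕ} {p : ℝ≥0∞}

theorem integrable_mul_of_hasCompactSupport [hp : Fact (1 ≤ p)]
    (F : Lp ℝ p (volume : Measure (EuclideanSpace ℝ (Fin n)))) {ψ : EuclideanSpace ℝ (Fin n) → ℝ}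
    (hψ : Continuous ψ) (hc : HasCompactSupport ψ) : Integrable fun x => F x * ψ x :=
  ((Lp.memLp F).locallyIntegrable hp.out).integrable_smul_right_of_hasCompactSupport hψ hc

theorem integrable_mul_comp_add [hp : Fact (1 ≤ p)]
    (F : Lp ℝ p (volume : Measure (EuclideanSpace ℝ (Fin n)))) {ψ : EuclideanSpace ℝ (Fin n) → ℝ}
    (hψ : Continuous ψ) (hc : HasCompactSupport ψ) (h : EuclideanSpace ℝ (Fin n)) :
    Integrable fun x => F x * ψ (x + h) :=
  integrable_mul_of_hasCompactSupport F (ψ := fun x => ψ (x + h)) (by fun_prop)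
    (hc.comp_homeomorph (Homeomorph.addRight h))

theorem exists_integral_norm_mul_sub_le [hp : Fact (1 ≤ p)]
    (F : Lp ℝ p (volume : Measure (EuclideanSpace ℝ (Fin n)))) {ψ : EuclideanSpace ℝ (Fin n) → ℝ}
    (hψ : Continuous ψ) (hc : HasCompactSupport ψ) :
    ∃ M, ∀ h, ∫ x, ‖F x * (ψ (x + h) - ψ x)‖ ≤ M := by
  obtain ⟨L, hL⟩ := exists_pairing (p := p) hψ.abs (hc.comp_left abs_zero)
  have hFabs := Lp.coeFn_abs F
  have hconv : ∀ h, ∫ x, |F x * ψ (x + h)| = L (lpTranslate (-h) |F|) := by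
    intro h
    rw [hL, integral_lpTranslate_mul]
    refine integral_congr_ae ?_
    filter_upwards [hFabs] with x hx
    simp [hx, abs_mul]
  have hle : ∀ h, ∫ x, |F x * ψ (x + h)| ≤ ‖L‖ * ‖F‖ := by
    intro h
    rw [hconv]
    refine (le_abs_self _).trans ((L.le_opNorm _).trans_eq ?_)
    rw [LinearIsometry.norm_map, norm_abs_eq_norm]
  refine ⟨‖L‖ * ‖F‖ + ‖L‖ * ‖F‖, fun h => ?_⟩
  have h0 := hle 0
  simp only [add_zero] at h0
  have i1 := (integrable_mul_comp_add F hψ hc h).abs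
  have i2 := (integrable_mul_of_hasCompactSupport F hψ hc).abs
  calc ∫ x, ‖F x * (ψ (x + h) - ψ x)‖ ≤ ∫ x, (|F x * ψ (x + h)| + |F x * ψ x|) := by
        refine integral_mono_of_nonneg (Eventually.of_forall fun _ => norm_nonneg _) (i1.add i2)
          (Eventually.of_forall fun x => ?_)
        simp only [mul_sub]
        exact abs_sub _ _
    _ = (∫ x, |F x * ψ (x + h)|) + ∫ x, |F x * ψ x| := integral_add i1 i2
    _ ≤ _ := add_le_add (hle h) h0

/-- ψ is Lipschitz, and for |h| < 1 the difference is supported in the compact 1-thickening of its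
support, where `F` is integrable. -/
theorem exists_integral_norm_mul_sub_le_norm [hp : Fact (1 ≤ p)]
    (F : Lp ℝ p (volume : Measure (EuclideanSpace ℝ (Fin n)))) {ψ : EuclideanSpace ℝ (Fin n) → ℝ}
    (hψ : ContDiff ℝ 1 ψ) (hc : HasCompactSupport ψ) :
    ∃ C, 0 ≤ C ∧ ∀ h ∈ Metric.ball (0 : EuclideanSpace ℝ (Fin n)) 1,
      ∫ x, ‖F x * (ψ (x + h) - ψ x)‖ ≤ C * ‖h‖ := by
  obtain ⟨K, hK⟩ := hψ.lipschitzWith_of_hasCompactSupport hc one_ne_zero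
  set S := Metric.cthickening 1 (tsupport ψ)
  have hS : IsCompact S := hc.isCompact.cthickening
  have hint : IntegrableOn F S := ((Lp.memLp F).locallyIntegrable hp.out).integrableOn_isCompact hS
  refine ⟨K * ∫ x in S, ‖F x‖, by positivity, fun h hh => ?_⟩
  rw [mem_ball_zero_iff] at hh
  rw [← integral_indicator hS.measurableSet, mul_right_comm, ← integral_const_mul]
  refine integral_mono_of_nonneg (Eventually.of_forall fun _ => norm_nonneg _)
    (((integrable_indicator_iff hS.measurableSet).2 hint.norm).const_mul _)
    (Eventually.of_forall fun x => ?_)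
  by_cases hx : x ∈ S
  · simp only [indicator_of_mem hx, norm_mul]
    have := hK.norm_sub_le (x + h) x
    rw [add_sub_cancel_left] at this
    rw [mul_comm]
    gcongr
  · have h1 : ψ x = 0 := image_eq_zero_of_notMem_tsupport fun hm =>
      hx (Metric.self_subset_cthickening _ hm)
    have h2 : ψ (x + h) = 0 := image_eq_zero_of_notMem_tsupport fun hm =>
      hx (Metric.mem_cthickening_of_dist_le x (x + h) 1 _ hm (by simpa using hh.le))
    simp [h1, h2, indicator_of_notMem hx]

/-- Justifies Fubini. After integration in x, the preceding bounds, uniform in h and linear near 0,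
let `integrable_coord_smul` handle the singularity and the tail. -/
theorem integrable_prod_mul_coord_div_mul_sub [hp : Fact (1 ≤ p)] (hn : 1 ≤ n) {α : ℝ}
    (hα : α ∈ Ioo (0 : ℝ) 1) (i : Fin n)
    (F : Lp ℝ p (volume : Measure (EuclideanSpace ℝ (Fin n)))) {ψ : EuclideanSpace ℝ (Fin n) → ℝ}
    (hψ : ContDiff ℝ 1 ψ) (hc : HasCompactSupport ψ) :
    Integrable (fun z : EuclideanSpace ℝ (Fin n) × EuclideanSpace ℝ (Fin n) =>
      (z.2 i / ‖z.2‖ ^ ((n : ℝ) + α + 1)) * (F z.1 * (ψ (z.1 + z.2) - ψ z.1)))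
      ((volume : Measure (EuclideanSpace ℝ (Fin n))).prod volume) := by
  have hcont := hψ.continuous
  have hm0 : AEStronglyMeasurable
      (fun z : EuclideanSpace ℝ (Fin n) × EuclideanSpace ℝ (Fin n) =>
        F z.1 * (ψ (z.1 + z.2) - ψ z.1))
      ((volume : Measure (EuclideanSpace ℝ (Fin n))).prod volume) :=
    (Lp.aestronglyMeasurable F).comp_fst.mul (Continuous.aestronglyMeasurable (by fun_prop))
  have hm : AEStronglyMeasurable
      (fun z : EuclideanSpace ℝ (Fin n) × EuclideanSpace ℝ (Fin n) =>
        (z.2 i / ‖z.2‖ ^ ((n : ℝ) + α + 1)) * (F z.1 * (ψ (z.1 + z.2) - ψ z.1)))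
      ((volume : Measure (EuclideanSpace ℝ (Fin n))).prod volume) :=
    ((measurable_coord_div_rpow i α).comp measurable_snd).aestronglyMeasurable.mul hm0
  rw [integrable_prod_iff' hm]
  constructor
  · refine Eventually.of_forall fun h => ?_
    have hi := (integrable_mul_comp_add F hcont hc h).sub
      (integrable_mul_of_hasCompactSupport F hcont hc)
    refine (hi.const_mul (h i / ‖h‖ ^ ((n : ℝ) + α + 1))).congr (Eventually.of_forall fun x => ?_)
    simp only [Pi.sub_apply, mul_sub]
  · obtain ⟨M, hM⟩ := exists_integral_norm_mul_sub_le F hcont hc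
    obtain ⟨C, hC, hC'⟩ := exists_integral_norm_mul_sub_le_norm F hψ hc
    have hnn : ∀ h, ‖∫ x, ‖F x * (ψ (x + h) - ψ x)‖‖ = ∫ x, ‖F x * (ψ (x + h) - ψ x)‖ := fun h =>
      Real.norm_of_nonneg (integral_nonneg fun _ => norm_nonneg _)
    have key := (integrable_coord_smul hn hα i
      (Ψ := fun h => ∫ x, ‖F x * (ψ (x + h) - ψ x)‖) hm0.norm.prod_swap.integral_prod_right'
      (fun h => (hnn h).trans_le (hM h)) hC one_pos fun h hh => (hnn h).trans_le (hC' h hh)).norm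
    refine key.congr (Eventually.of_forall fun h => ?_)
    simp only [norm_mul, norm_smul, integral_const_mul]
    rw [Real.norm_of_nonneg (integral_nonneg fun x => by positivity)]

/-- The fractional difference quotient pairs with a test function as the fractional derivative of
the test function pairs with the function. -/
theorem integral_integral_coord_div_mul_sub [hp : Fact (1 ≤ p)] (hn : 1 ≤ n)
    {α : ℝ} (hα : α ∈ Ioo (0 : ℝ) 1) (i : Fin n)
    (F : Lp ℝ p (volume : Measure (EuclideanSpace ℝ (Fin n)))) {ψ : EuclideanSpace ℝ (Fin n) → ℝ}
    (hψ : ContDiff ℝ 1 ψ) (hc : HasCompactSupport ψ)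
    (hint : Integrable fun h : EuclideanSpace ℝ (Fin n) =>
      (h i / ‖h‖ ^ ((n : ℝ) + α + 1)) • (lpTranslate h F - F)) :
    ∫ x, ∫ h : EuclideanSpace ℝ (Fin n),
      (h i / ‖h‖ ^ ((n : ℝ) + α + 1)) * (F x * (ψ (x + h) - ψ x)) =
      -∫ x, (∫ h : EuclideanSpace ℝ (Fin n),
        (h i / ‖h‖ ^ ((n : ℝ) + α + 1)) • (lpTranslate h F - F)) x * ψ x := by
  obtain ⟨L, hL⟩ := exists_pairing (p := p) hψ.continuous hc
  -- Translating ψ by h amounts to translating `F` by -h, and the kernel is odd: this produces the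
  -- minus sign of integration by parts.
  have hpair : ∀ h : EuclideanSpace ℝ (Fin n),
      ∫ x, (h i / ‖h‖ ^ ((n : ℝ) + α + 1)) * (F x * (ψ (x + h) - ψ x)) =
        -L (((-h) i / ‖-h‖ ^ ((n : ℝ) + α + 1)) • (lpTranslate (-h) F - F)) := by
    intro h
    rw [integral_const_mul]
    simp only [mul_sub]
    rw [integral_sub (integrable_mul_comp_add F hψ.continuous hc h)
      (integrable_mul_of_hasCompactSupport F hψ.continuous hc), map_smul, map_sub, hL, hL,
      integral_lpTranslate_mul, norm_neg, PiLp.neg_apply, smul_eq_mul]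
    simp only [sub_neg_eq_add]
    ring
  rw [integral_integral_swap (integrable_prod_mul_coord_div_mul_sub hn hα i F hψ hc), ← hL,
    ← L.integral_comp_comm hint, ← integral_neg]
  simp only [hpair]
  exact integral_neg_eq_self (fun h : EuclideanSpace ℝ (Fin n) =>
    -L ((h i / ‖h‖ ^ ((n : ℝ) + α + 1)) • (lpTranslate h F - F))) volume

theorem mul_fracDivergence_eq (α c : ℝ) (φ : EuclideanSpace ℝ (Fin n) → EuclideanSpace ℝ (Fin n))
    (x : EuclideanSpace ℝ (Fin n)) :
    c * fracDivergence α φ x = fracConst n α * ∫ h : EuclideanSpace ℝ (Fin n), ∑ i,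
      (h i / ‖h‖ ^ ((n : ℝ) + α + 1)) * (c * (φ (x + h) i - φ x i)) := by
  rw [fracDivergence, mul_left_comm, ← integral_const_mul, ← integral_add_left_eq_self _ x]
  congr 1
  refine integral_congr_ae (Eventually.of_forall fun h => ?_)
  simp only [add_sub_cancel_left, PiLp.inner_apply, RCLike.inner_apply, conj_trivial,
    PiLp.sub_apply, Finset.sum_div, Finset.mul_sum]
  exact Finset.sum_congr rfl fun i _ => by ring

theorem IsTestField.coord {φ : EuclideanSpace ℝ (Fin n) → EuclideanSpace ℝ (Fin n)}
    (hφ : IsTestField φ) (i : Fin n) :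
    ContDiff ℝ ((⊤ : ℕ∞) : WithTop ℕ∞) (fun x => φ x i) ∧ HasCompactSupport fun x => φ x i :=
  ⟨(EuclideanSpace.proj (𝕜 := ℝ) i).contDiff.comp hφ.1,
    hφ.2.comp_left (g := fun v : EuclideanSpace ℝ (Fin n) => v i) rfl⟩

theorem isWeakFracGradient_of_integrable [hp : Fact (1 ≤ p)] (hn : 1 ≤ n)
    {α : ℝ} (hα : α ∈ Ioo (0 : ℝ) 1) {f : EuclideanSpace ℝ (Fin n) → ℝ} (hf : MemLp f p volume)
    (hint : ∀ i, Integrable fun h : EuclideanSpace ℝ (Fin n) =>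
      (h i / ‖h‖ ^ ((n : ℝ) + α + 1)) • (lpTranslate h hf.toLp - hf.toLp))
    {G : EuclideanSpace ℝ (Fin n) → EuclideanSpace ℝ (Fin n)} (hG : MemLp G p volume)
    (hGi : ∀ i, (fun x => G x i) =ᵐ[volume] (fracConst n α • ∫ h : EuclideanSpace ℝ (Fin n),
      (h i / ‖h‖ ^ ((n : ℝ) + α + 1)) • (lpTranslate h hf.toLp - hf.toLp) :
        Lp ℝ p (volume : Measure (EuclideanSpace ℝ (Fin n))))) :
    IsWeakFracGradient α f G := by
  refine ⟨hG.locallyIntegrable hp.out, fun φ hφ => ?_⟩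
  set F := hf.toLp with hF
  have hφ1 : ∀ i, ContDiff ℝ 1 fun x => φ x i := fun i =>
    (hφ.coord i).1.of_le (by exact_mod_cast le_top)
  have hI := fun i => integrable_prod_mul_coord_div_mul_sub hn hα i F (hφ1 i) (hφ.coord i).2
  have hleft : ∫ x, f x * fracDivergence α φ x = fracConst n α * ∑ i, ∫ x,
      ∫ h : EuclideanSpace ℝ (Fin n),
        (h i / ‖h‖ ^ ((n : ℝ) + α + 1)) * (F x * (φ (x + h) i - φ x i)) := by
    rw [← integral_finsetSum _ fun i _ => (hI i).integral_prod_left, ← integral_const_mul]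
    refine integral_congr_ae ?_
    filter_upwards [hf.coeFn_toLp, eventually_countable_forall.2 fun i => (hI i).prod_right_ae]
      with x hx hxi
    rw [← hx, mul_fracDivergence_eq, integral_finsetSum _ fun i _ => hxi i]
  have hGL : ∀ i, ∃ v : Lp ℝ p (volume : Measure (EuclideanSpace ℝ (Fin n))),
      (fun x => G x i) =ᵐ[volume] v := fun i => ⟨_, hGi i⟩
  have hright : ∫ x, inner ℝ (G x) (φ x) = ∑ i, ∫ x, G x i * φ x i := by
    rw [← integral_finsetSum]
    · simp [PiLp.inner_apply, mul_comm]
    · intro i _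
      obtain ⟨v, hv⟩ := hGL i
      refine (integrable_mul_of_hasCompactSupport v (hφ1 i).continuous (hφ.coord i).2).congr ?_
      filter_upwards [hv] with x hx
      rw [hx]
  rw [hleft, hright, Finset.mul_sum, ← Finset.sum_neg_distrib]
  refine Finset.sum_congr rfl fun i _ => ?_
  rw [integral_integral_coord_div_mul_sub hn hα i F (hφ1 i) (hφ.coord i).2 (hint i), mul_neg,
    ← integral_const_mul]
  congr 1
  refine integral_congr_ae ?_
  filter_upwards [hGi i, Lp.coeFn_smul (fracConst n α) (∫ h : EuclideanSpace ℝ (Fin n),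
      (h i / ‖h‖ ^ ((n : ℝ) + α + 1)) • (lpTranslate h F - F))] with x h1 h2
  rw [h1, h2, Pi.smul_apply, smul_eq_mul, mul_assoc]

end WeakFormulation

/-! ### Uniqueness of weak gradients, and the conclusion. -/

section Main

variable {n : ℕ} {p : ℝ≥0∞}

theorem divergence_smul_const {ψ : EuclideanSpace ℝ (Fin n) → ℝ} (hψ : Differentiable ℝ ψ)
    (v x : EuclideanSpace ℝ (Fin n)) :
    divergence (fun y => ψ y • v) x = fderiv ℝ ψ x v := by
  have hsum : v = ∑ j, v j • EuclideanSpace.single j (1 : ℝ) := by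
    ext j; simp [Finset.sum_apply, Pi.single_apply]
  conv_rhs => rw [hsum]
  simp [divergence, fderiv_smul_const (hψ x), mul_comm]

theorem isTestField_smul_const {ψ : EuclideanSpace ℝ (Fin n) → ℝ}
    (hψ : ContDiff ℝ ((⊤ : ℕ∞) : WithTop ℕ∞) ψ) (hc : HasCompactSupport ψ)
    (v : EuclideanSpace ℝ (Fin n)) : IsTestField fun y => ψ y • v :=
  ⟨hψ.smul contDiff_const, hc.smul_right⟩

/-- Fields ψ v with v constant suffice: they determine the vector-valued integrals of ψ g. -/
theorem ae_eq_of_forall_integral_inner_eq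
    {g g' : EuclideanSpace ℝ (Fin n) → EuclideanSpace ℝ (Fin n)}
    (hg : LocallyIntegrable g volume) (hg' : LocallyIntegrable g' volume)
    (h : ∀ φ, IsTestField φ → ∫ x, inner ℝ (g x) (φ x) = ∫ x, inner ℝ (g' x) (φ x)) :
    g =ᵐ[volume] g' := by
  refine ae_eq_of_integral_contDiff_smul_eq hg hg' fun ψ hψ hc => ?_
  refine ext_inner_right ℝ fun v => ?_
  have h1 := hg.integrable_smul_left_of_hasCompactSupport hψ.continuous hc
  have h2 := hg'.integrable_smul_left_of_hasCompactSupport hψ.continuous hc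
  rw [real_inner_comm, ← integral_inner h1, real_inner_comm, ← integral_inner h2]
  simpa [inner_smul_left, inner_smul_right, real_inner_comm] using
    h _ (isTestField_smul_const hψ hc v)

theorem IsWeakGradient.ae_eq {f : EuclideanSpace ℝ (Fin n) → ℝ}
    {g g' : EuclideanSpace ℝ (Fin n) → EuclideanSpace ℝ (Fin n)}
    (hg : IsWeakGradient f g) (hg' : IsWeakGradient f g') : g =ᵐ[volume] g' :=
  ae_eq_of_forall_integral_inner_eq hg.1 hg'.1 fun φ hφ =>
    neg_injective ((hg.2 φ hφ).symm.trans (hg'.2 φ hφ))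

theorem IsWeakFracGradient.ae_eq {α : ℝ} {f : EuclideanSpace ℝ (Fin n) → ℝ}
    {g g' : EuclideanSpace ℝ (Fin n) → EuclideanSpace ℝ (Fin n)}
    (hg : IsWeakFracGradient α f g) (hg' : IsWeakFracGradient α f g') : g =ᵐ[volume] g' :=
  ae_eq_of_forall_integral_inner_eq hg.1 hg'.1 fun φ hφ =>
    neg_injective ((hg.2 φ hφ).symm.trans (hg'.2 φ hφ))

/-- The linear map `h ↦ g · h` into `Lᵖ`. -/
noncomputable def lpDirectional [Fact (1 ≤ p)]
    {g : EuclideanSpace ℝ (Fin n) → EuclideanSpace ℝ (Fin n)} (hg : MemLp g p volume) :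
    EuclideanSpace ℝ (Fin n) →L[ℝ] Lp ℝ p (volume : Measure (EuclideanSpace ℝ (Fin n))) :=
  ∑ i, (EuclideanSpace.proj (𝕜 := ℝ) i).smulRight (hg.eval_piLp i).toLp

theorem lpDirectional_coeFn [Fact (1 ≤ p)]
    {g : EuclideanSpace ℝ (Fin n) → EuclideanSpace ℝ (Fin n)} (hg : MemLp g p volume)
    (h : EuclideanSpace ℝ (Fin n)) :
    lpDirectional hg h =ᵐ[volume] fun x => inner ℝ (g x) h := by
  have e : lpDirectional hg h = ∑ i, h i • (hg.eval_piLp i).toLp := by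
    simp [lpDirectional]
  rw [e]
  filter_upwards [Lp.coeFn_fun_finsetSum Finset.univ fun i => h i • (hg.eval_piLp i).toLp,
    eventually_countable_forall.2 fun i => Lp.coeFn_smul (h i) (hg.eval_piLp i).toLp,
    eventually_countable_forall.2 fun i => (hg.eval_piLp i).coeFn_toLp] with x h1 h2 h3
  rw [h1]
  simp [PiLp.inner_apply, h2, h3]

theorem lpDirectional_single [Fact (1 ≤ p)]
    {g : EuclideanSpace ℝ (Fin n) → EuclideanSpace ℝ (Fin n)} (hg : MemLp g p volume) (i : Fin n) :
    lpDirectional hg (EuclideanSpace.single i 1) = (hg.eval_piLp i).toLp := by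
  simp [lpDirectional]

theorem IsWeakGradient.hasFDerivAt_lpTranslate_sub [hp : Fact (1 ≤ p)] (hpt : p ≠ ⊤)
    {f : EuclideanSpace ℝ (Fin n) → ℝ} (hf : MemLp f p volume)
    {g : EuclideanSpace ℝ (Fin n) → EuclideanSpace ℝ (Fin n)} (hfg : IsWeakGradient f g)
    (hg : MemLp g p volume) :
    HasFDerivAt (fun h => lpTranslate h hf.toLp - hf.toLp) (lpDirectional hg) 0 := by
  refine (hasFDerivAt_lpTranslate hpt _ _ fun ψ hψ hc v => ?_).sub_const _
  have key := hfg.2 _ (isTestField_smul_const hψ hc v)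
  simp only [divergence_smul_const (hψ.differentiable (by simp)), inner_smul_right] at key
  rw [integral_congr_ae (g := fun x => f x * fderiv ℝ ψ x v), key]
  · congr 1
    refine integral_congr_ae ?_
    filter_upwards [lpDirectional_coeFn hg v] with x hx
    rw [hx, mul_comm]
  · filter_upwards [hf.coeFn_toLp] with x hx
    rw [hx]

theorem eLpNorm_le_sum_eLpNorm_coord (hp : 1 ≤ p)
    {v : EuclideanSpace ℝ (Fin n) → EuclideanSpace ℝ (Fin n)}
    (hv : ∀ i, AEStronglyMeasurable (fun x => v x i) volume) :
    eLpNorm v p volume ≤ ∑ i, eLpNorm (fun x => v x i) p volume := by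
  calc eLpNorm v p volume ≤ eLpNorm (∑ i, fun x => ‖v x i‖) p volume := by
        refine eLpNorm_mono_real fun x => ?_
        have hsum : v x = ∑ j, v x j • EuclideanSpace.single j (1 : ℝ) := by
          ext j; simp [Finset.sum_apply, Pi.single_apply]
        conv_lhs => rw [hsum]
        refine (norm_sum_le _ _).trans_eq ?_
        simp [norm_smul]
    _ ≤ ∑ i, eLpNorm (fun x => ‖v x i‖) p volume := eLpNorm_sum_le (fun i _ => (hv i).norm) hp
    _ = _ := by simp only [eLpNorm_norm]

end Main

theorem mainTheorem5 (n : ℕ) (hn : 1 ≤ n) (p : ℝ≥0∞) (hp1 : 1 < p) (hp : p < ⊤)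
    (f : EuclideanSpace ℝ (Fin n) → ℝ) (hf : MemSobolevOne p f) :
    (∀ α ∈ Ioo (0 : ℝ) 1, MemFracSobolev α p f) ∧
      ∀ g : EuclideanSpace ℝ (Fin n) → EuclideanSpace ℝ (Fin n), IsWeakGradient f g →
        ∀ G : ℝ → EuclideanSpace ℝ (Fin n) → EuclideanSpace ℝ (Fin n),
          (∀ α ∈ Ioo (0 : ℝ) 1, IsWeakFracGradient α f (G α)) →
            Tendsto (fun α : ℝ => eLpNorm (fun x => G α x - g x) p volume)
              (𝓝[<] 1) (𝓝 0) := by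
  have : Fact (1 ≤ p) := ⟨hp1.le⟩
  obtain ⟨hfp, g₀, hfg₀, hg₀⟩ := hf
  have hΨ : Continuous fun h => lpTranslate h hfp.toLp - hfp.toLp :=
    (continuous_lpTranslate hp.ne _).sub continuous_const
  have hb : ∀ h, ‖lpTranslate h hfp.toLp - hfp.toLp‖ ≤ ‖hfp.toLp‖ + ‖hfp.toLp‖ := fun h =>
    (norm_sub_le _ _).trans_eq (by rw [LinearIsometry.norm_map])
  have h0 : lpTranslate 0 hfp.toLp - hfp.toLp = 0 := by rw [lpTranslate_zero, sub_self]
  have hD := hfg₀.hasFDerivAt_lpTranslate_sub hp.ne hfp hg₀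
  let J : ℝ → Fin n → Lp ℝ p (volume : Measure (EuclideanSpace ℝ (Fin n))) := fun α i =>
    fracConst n α • ∫ h : EuclideanSpace ℝ (Fin n),
      (h i / ‖h‖ ^ ((n : ℝ) + α + 1)) • (lpTranslate h hfp.toLp - hfp.toLp)
  let G₀ : ℝ → EuclideanSpace ℝ (Fin n) → EuclideanSpace ℝ (Fin n) := fun α x =>
    WithLp.toLp 2 fun i => J α i x
  have hG₀ : ∀ α, MemLp (G₀ α) p volume := fun α => MemLp.of_eval_piLp fun i => Lp.memLp (J α i)
  have hweak : ∀ α ∈ Ioo (0 : ℝ) 1, IsWeakFracGradient α f (G₀ α) := fun α hα =>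
    isWeakFracGradient_of_integrable hn hα hfp
      (fun i => hD.integrable_coord_smul hn hα i hΨ hb h0) (hG₀ α) fun i => EventuallyEq.rfl
  refine ⟨fun α hα => ⟨hfp, G₀ α, hweak α hα, hG₀ α⟩, fun g hg G hG => ?_⟩
  have hlim : Tendsto (fun α => ∑ i, ‖J α i - (hg₀.eval_piLp i).toLp‖ₑ) (𝓝[<] 1) (𝓝 0) := by
    rw [← Finset.sum_const_zero (s := (Finset.univ : Finset (Fin n)))]
    refine tendsto_finsetSum _ fun i _ => ?_
    have := tendsto_fracConst_smul_integral hn i hΨ hb h0 hD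
    rw [lpDirectional_single] at this
    have h2 := (this.sub_const (hg₀.eval_piLp i).toLp).enorm
    rwa [sub_self, enorm_zero] at h2
  refine tendsto_of_tendsto_of_tendsto_of_le_of_le' tendsto_const_nhds hlim
    (Eventually.of_forall fun _ => zero_le) ?_
  filter_upwards [Ioo_mem_nhdsLT (zero_lt_one' ℝ)] with α hα
  -- By uniqueness the arbitrary gradients may be exchanged for the constructed ones, which are
  -- known to lie in Lᵖ.
  have hae : (fun x => G α x - g x) =ᵐ[volume] fun x => G₀ α x - g₀ x := by
    filter_upwards [(hG α hα).ae_eq (hweak α hα), hg.ae_eq hfg₀] with x h1 h2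
    rw [h1, h2]
  rw [eLpNorm_congr_ae hae]
  have hmem : MemLp (fun x => G₀ α x - g₀ x) p volume := (hG₀ α).sub hg₀
  refine (eLpNorm_le_sum_eLpNorm_coord hp1.le
    fun i => (hmem.eval_piLp i).aestronglyMeasurable).trans_eq ?_
  refine Finset.sum_congr rfl fun i _ => ?_
  rw [Lp.enorm_def]
  refine eLpNorm_congr_ae ?_
  filter_upwards [Lp.coeFn_sub (J α i) (hg₀.eval_piLp i).toLp, (hg₀.eval_piLp i).coeFn_toLp]
    with x h1 h2
  rw [h1, Pi.sub_apply, h2]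
  rfl
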